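/- Let $K(x)=\tfrac12 e^{-|x|}$ and let $L=(1-\partial_x^2)^{-1}$ be the convolution operator $(Lf)(x)=\int_{\mathbb R}K(y)f(x-y)\,dy$. Let $I\subseteq\mathbb R$ be a (nondegenerate, possibly unbounded) interval of times and let $u=u(t,x)$ be a classical solution on $I\times\mathbb R$ of the nonlocal Degasperis–Procesi equation $$\partial_t u+u\,\partial_x u+\partial_x L\!\left(\tfrac32u^2\right)=0,$$ that is, $u\in C^1(I\times\mathbb R)$, for every $t\in I$ the integral defining $L(u^2)(t,\cdot)$ converges absolutely at every point and defines a differentiable function of $x$, and the equation holds at every $(t,x)\in I\times\mathbb R$ (with one-sided time derivatives at endpoints of $I$ that belong to $I$). Suppose that there is $\lambda\in C^1(I)$ such that $$u(t,x)=u(t,2\lambda(t)-x)\qquad\text{for all }t\in I,\ x\in\mathbb R .$$ Then $u$ is a traveling wave. More precisely, there are a function $g\in C^1(\mathbb R)$ and constants $b,c\in\mathbb R$ such that $$u(t,x)=g(x-\lambda(t))=g(x-b-ct)\qquad\text{for all }t\in I,\ x\in\mathbb R,$$ the integral defining $L(g^2)$ converges absolutely at every point, and $g$ solves the steady equation $$\frac{g}{3}\,(2c-g)=L(g^2)+a\qquad\text{on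 }\mathbb R$$ for some constant $a\in\mathbb R$. Moreover, if $u$ is not constant on $I\times\mathbb R$, then $\dot\lambda(t)=c$ and $\lambda(t)=b+ct$ for all $t\in I$; that is, the wave propagates with the constant speed $\dot\lambda$. -/

import Mathlib

open MeasureTheory Set

noncomputable section

namespace DegasperisProcesi

/-- The kernel `K(x) = e^{-|x|} / 2` of the operator `L = (1 - ∂ₓ²)⁻¹` on the real line. -/
def kernel (x : ℝ) : ℝ := (1 / 2) * Real.exp (-|x|)

/-- The operator `L = (1 - ∂ₓ²)⁻¹`, i.e. convolution with `K`:
`(L f)(x) = ∫ K(y) f(x - y) dy`. -/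
def L (f : ℝ → ℝ) : ℝ → ℝ :=
  convolution kernel f (ContinuousLinearMap.mul ℝ ℝ) volume

/-- The integral defining `L f` converges absolutely at every point
(this holds, for instance, for every bounded measurable `f`). -/
def LExists (f : ℝ → ℝ) : Prop :=
  ConvolutionExists kernel f (ContinuousLinearMap.mul ℝ ℝ) volume

/-- `u` (written `u t x`) is a classical solution, for times `t` in the interval `I`, of
`∂ₜ u + u ∂ₓ u + ∂ₓ L(3/2 u²) = 0`. At an endpoint of `I` belonging to `I`, the time derivative
is one-sided. No boundedness, decay or periodicity in `x` is imposed beyond convergence of the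
integral that defines `L(u²)`. -/
structure IsClassicalSolution (I : Set ℝ) (u : ℝ → ℝ → ℝ) : Prop where
  contDiffOn : ContDiffOn ℝ 1 (fun p : ℝ × ℝ => u p.1 p.2) (I ×ˢ univ)
  lExists : ∀ t ∈ I, LExists (fun y => (3 / 2) * u t y ^ 2)
  differentiable_L : ∀ t ∈ I, Differentiable ℝ (L (fun y => (3 / 2) * u t y ^ 2))
  equation : ∀ t ∈ I, ∀ x : ℝ,
    derivWithin (fun s => u s x) I t + u t x * deriv (u t) x
      + deriv (L (fun y => (3 / 2) * u t y ^ 2)) x = 0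

/-- `u(t, ·)` is symmetric about the axis `x = lam t` for every time `t ∈ I`. -/
def IsSymmetricAbout (I : Set ℝ) (u : ℝ → ℝ → ℝ) (lam : ℝ → ℝ) : Prop :=
  ∀ t ∈ I, ∀ x : ℝ, u t x = u t (2 * lam t - x)

/-- `φ` is a continuously differentiable solution of the steady equation with wave speed `c`,
`(φ / 3) (2 c - φ) = L(φ²) + a`, for some integration constant `a`. -/
structure IsSteadySolution (c : ℝ) (φ : ℝ → ℝ) : Prop where
  contDiff : ContDiff ℝ 1 φ
  lExists : LExists (fun y => φ y ^ 2)
  equation : ∃ a : ℝ, ∀ x : ℝ, φ x / 3 * (2 * c - φ x) = L (fun y => φ y ^ 2) x + a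

end DegasperisProcesi

end

namespace DegasperisProcesi

/-! Under reflection in the axis, `u` is even, while `u * u_x` and the nonlocal term are odd since
the kernel is even. Comparing the equation at mirror points with the time derivative of the symmetry
gives `u_t + lam' * u_x = 0` (`IsClassicalSolution.transport`), so `u` is a fixed profile `g`
carried along by `lam`. The equation becomes an ODE for `g` with coefficient `lam' t`. One time
gives the steady equation by integration; varying the time forces `lam'` to be constant unless `g' =
0` everywhere. -/

theorem L_reflect {f : ℝ → ℝ} {m : ℝ} (hf : ∀ x, f x = f (2 * m - x)) (x : ℝ) :
    L f x = L f (2 * m - x) := by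
  simp only [L, convolution_def, ContinuousLinearMap.mul_apply']
  rw [← integral_neg_eq_self]
  refine integral_congr_ae (Filter.Eventually.of_forall fun y => ?_)
  simp only [kernel, abs_neg]
  rw [hf (x - -y)]
  ring_nf

theorem L_translate (f : ℝ → ℝ) (m x : ℝ) : L (fun y => f (y + m)) x = L f (x + m) := by
  simp only [L, convolution_def, ContinuousLinearMap.mul_apply']
  refine integral_congr_ae (Filter.Eventually.of_forall fun y => ?_)
  simp only
  ring_nf

theorem L_const_mul (k : ℝ) (f : ℝ → ℝ) (x : ℝ) : L (fun y => k * f y) x = k * L f x := by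
  simp only [L, convolution_def, ContinuousLinearMap.mul_apply']
  rw [← integral_const_mul]
  refine integral_congr_ae (Filter.Eventually.of_forall fun y => ?_)
  simp only
  ring

theorem LExists.const_mul {f : ℝ → ℝ} (hf : LExists f) (k : ℝ) :
    LExists (fun y => k * f y) := fun x => by
  have h := (hf x).integrable.const_mul k
  refine h.congr (Filter.Eventually.of_forall fun y => ?_)
  simp only [ContinuousLinearMap.mul_apply']
  ring

theorem LExists.translate {f : ℝ → ℝ} (hf : LExists f) (m : ℝ) :
    LExists (fun y => f (y + m)) := fun x => by
  refine (hf (x + m)).integrable.congr (Filter.Eventually.of_forall fun y => ?_)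
  simp only [ContinuousLinearMap.mul_apply']
  ring_nf

/-- Chain rule along a curve `s ↦ (s, γ s)` for a function that is `C¹` on `I × ℝ`, with the total
derivative expressed through the partial derivatives. -/
theorem hasDerivWithinAt_along_curve {I : Set ℝ} (hI : UniqueDiffOn ℝ I) {u : ℝ → ℝ → ℝ}
    (hu : ContDiffOn ℝ 1 (fun p : ℝ × ℝ => u p.1 p.2) (I ×ˢ univ)) {t : ℝ} (ht : t ∈ I)
    {γ : ℝ → ℝ} {γ' : ℝ} (hγ : HasDerivWithinAt γ γ' I t) :
    HasDerivWithinAt (fun s => u s (γ s))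
      (derivWithin (fun s => u s (γ t)) I t + γ' * deriv (u t) (γ t)) I t := by
  obtain ⟨D, hD⟩ := (hu.differentiableOn one_ne_zero) (t, γ t) ⟨ht, mem_univ _⟩
  -- An arbitrary curve through the base point: the constant one yields the time partial, `γ` the
  -- total derivative.
  have curve : ∀ {η : ℝ → ℝ} {η' : ℝ}, η t = γ t → HasDerivWithinAt η η' I t →
      HasDerivWithinAt (fun s => u s (η s)) (D (1, η')) I t := by
    intro η η' hηt hη
    have hp : HasDerivWithinAt (fun s => (s, η s)) ((1 : ℝ), η') I t :=
      (hasDerivWithinAt_id t I).prodMk hη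
    rw [← hηt] at hD
    have hm : MapsTo (fun s => (s, η s)) I (I ×ˢ univ) := fun s hs => ⟨hs, mem_univ _⟩
    exact hD.comp_hasDerivWithinAt t hp hm
  have h1 : derivWithin (fun s => u s (γ t)) I t = D (1, 0) :=
    (curve (η := fun _ => γ t) rfl (hasDerivWithinAt_const t I _)).derivWithin (hI t ht)
  have h2 : deriv (u t) (γ t) = D (0, 1) := by
    have hp : HasDerivWithinAt (fun x => (t, x)) ((0 : ℝ), (1 : ℝ)) univ (γ t) :=
      (hasDerivWithinAt_const _ _ _).prodMk (hasDerivWithinAt_id _ _)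
    have hm : MapsTo (fun x : ℝ => (t, x)) univ (I ×ˢ univ) := fun s _ => ⟨ht, mem_univ s⟩
    have h : HasDerivWithinAt (u t) (D (0, 1)) univ (γ t) :=
      hD.comp_hasDerivWithinAt (γ t) hp hm
    exact (hasDerivWithinAt_univ.1 h).deriv
  convert curve rfl hγ using 1
  rw [h1, h2, ← smul_eq_mul, ← map_smul, ← map_add]
  simp

theorem uniqueDiffOn_of_ordConnected {I : Set ℝ} (hI : I.OrdConnected) (hI' : I.Nontrivial) :
    UniqueDiffOn ℝ I :=
  uniqueDiffOn_convex hI.convex (hI.convex.nontrivial_iff_nonempty_interior.1 hI')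

/-- On an interval, a function with zero derivative within the interval is constant. -/
theorem eq_of_hasDerivWithinAt_zero {I : Set ℝ} (hI : I.OrdConnected) {f : ℝ → ℝ}
    (hf : ∀ t ∈ I, HasDerivWithinAt f 0 I t) {s t : ℝ} (hs : s ∈ I) (ht : t ∈ I) :
    f s = f t := by
  have h := hI.convex.norm_image_sub_le_of_norm_hasDerivWithin_le (C := 0) hf (by simp) hs ht
  rw [zero_mul, norm_le_zero_iff, sub_eq_zero] at h
  exact h.symm

/-- A solution that is symmetric about `x = lam t` is transported with the velocity of the axis. -/
theorem IsClassicalSolution.transport {I : Set ℝ} (hI : UniqueDiffOn ℝ I) {u : ℝ → ℝ → ℝ}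
    (hu : IsClassicalSolution I u) {lam : ℝ → ℝ} (hsymm : IsSymmetricAbout I u lam) {t lam' : ℝ}
    (ht : t ∈ I) (hlam : HasDerivWithinAt lam lam' I t) (x : ℝ) :
    derivWithin (fun s => u s x) I t + lam' * deriv (u t) x = 0 := by
  have hux : ∀ y, deriv (u t) (2 * lam t - y) = -deriv (u t) y := fun y => by
    have h := deriv_comp_const_sub (f := u t) (2 * lam t) y
    rw [← funext (hsymm t ht)] at h
    linarith
  have hPx : ∀ y, deriv (L fun z => 3 / 2 * u t z ^ 2) (2 * lam t - y)
      = -deriv (L fun z => 3 / 2 * u t z ^ 2) y := fun y => by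
    have hP := L_reflect (f := fun z => 3 / 2 * u t z ^ 2) (m := lam t)
      fun z => by simp only [← hsymm t ht z]
    have h := deriv_comp_const_sub (f := L fun z => 3 / 2 * u t z ^ 2) (2 * lam t) y
    rw [← funext hP] at h
    linarith
  have hut := (hasDerivWithinAt_along_curve hI hu.contDiffOn ht
    ((hlam.const_mul 2).sub_const x)).derivWithin (hI t ht)
  rw [← derivWithin_congr (fun s hs => hsymm s hs x) (hsymm t ht x), hux] at hut
  -- The odd terms cancel in `e1 + e2`, so the time derivatives at the mirror points are opposite;
  -- `hut` says they differ by `-2 * lam' * u_x`.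
  have e1 := hu.equation t ht x
  have e2 := hu.equation t ht (2 * lam t - x)
  rw [hux, hPx, ← hsymm t ht x] at e2
  linarith

end DegasperisProcesi

open DegasperisProcesi in
theorem mainTheorem4 (I : Set ℝ) (hI : I.OrdConnected) (hI' : I.Nontrivial)
    (u : ℝ → ℝ → ℝ) (hu : DegasperisProcesi.IsClassicalSolution I u)
    (lam : ℝ → ℝ) (hlam : ContDiffOn ℝ 1 lam I)
    (hsymm : DegasperisProcesi.IsSymmetricAbout I u lam) :
    ∃ (g : ℝ → ℝ) (c b : ℝ),
      DegasperisProcesi.IsSteadySolution c g ∧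
      (∀ t ∈ I, ∀ x : ℝ, u t x = g (x - lam t)) ∧
      (∀ t ∈ I, ∀ x : ℝ, u t x = g (x - (b + c * t))) ∧
      ((¬ ∃ k : ℝ, ∀ t ∈ I, ∀ x : ℝ, u t x = k) →
        ∀ t ∈ I, HasDerivWithinAt lam c I t ∧ lam t = b + c * t) := by
  have hU := uniqueDiffOn_of_ordConnected hI hI'
  have hlam' : ∀ t ∈ I, HasDerivWithinAt lam (derivWithin lam I t) I t := fun t ht =>
    (hlam.differentiableOn one_ne_zero t ht).hasDerivWithinAt
  obtain ⟨t₀, ht₀⟩ := hI'.nonempty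
  set g : ℝ → ℝ := fun y => u t₀ (y + lam t₀) with hg
  have hug : ∀ t ∈ I, ∀ x, u t x = g (x - lam t) := by
    intro t ht x
    have h : ∀ s ∈ I, HasDerivWithinAt (fun r => u r (x - lam t + lam r)) 0 I s := fun s hs => by
      have h := hasDerivWithinAt_along_curve hU hu.contDiffOn hs
        ((hlam' s hs).const_add (x - lam t))
      rwa [hu.transport hU hsymm hs (hlam' s hs)] at h
    simpa [hg] using eq_of_hasDerivWithinAt_zero hI h ht ht₀
  have hgC : ContDiff ℝ 1 g := by
    rw [← contDiffOn_univ]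
    exact hu.contDiffOn.comp (g := fun p : ℝ × ℝ => u p.1 p.2) (f := fun y => (t₀, y + lam t₀))
      (by fun_prop) fun y _ => ⟨ht₀, mem_univ _⟩
  have hgd : Differentiable ℝ g := hgC.differentiable one_ne_zero
  have hgL : LExists fun y => g y ^ 2 := by
    convert ((hu.lExists t₀ ht₀).const_mul (2 / 3)).translate (lam t₀) using 2
    ring
  have hPg : ∀ t ∈ I, ∀ x, L (fun y => 3 / 2 * u t y ^ 2) x
      = 3 / 2 * L (fun y => g y ^ 2) (x - lam t) := fun t ht x => by
    have h : (fun y => 3 / 2 * u t y ^ 2) = fun y => 3 / 2 * g (y + -lam t) ^ 2 := by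
      funext y
      rw [hug t ht y, sub_eq_add_neg]
    rw [h, L_const_mul, L_translate (fun y => g y ^ 2), sub_eq_add_neg]
  have hLd : Differentiable ℝ (L fun y => g y ^ 2) := by
    have h : (L fun y => g y ^ 2) = fun x => 2 / 3 * L (fun y => 3 / 2 * u t₀ y ^ 2) (x + lam t₀) := by
      funext x
      rw [hPg t₀ ht₀, add_sub_cancel_right]
      ring
    rw [h]
    exact ((hu.differentiable_L t₀ ht₀).comp (differentiable_id.add_const _)).const_mul _
  have hode : ∀ t ∈ I, ∀ y, -derivWithin lam I t * deriv g y + g y * deriv g y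
      + 3 / 2 * deriv (L fun y => g y ^ 2) y = 0 := by
    intro t ht y
    have e := hu.equation t ht (y + lam t)
    have e' := hu.transport hU hsymm ht (hlam' t ht) (y + lam t)
    have hx : deriv (u t) (y + lam t) = deriv g y := by
      rw [funext (hug t ht), deriv_comp_sub_const, add_sub_cancel_right]
    have hP : deriv (L fun y => 3 / 2 * u t y ^ 2) (y + lam t)
        = 3 / 2 * deriv (L fun y => g y ^ 2) y := by
      rw [funext (hPg t ht), deriv_const_mul_field, deriv_comp_sub_const, add_sub_cancel_right]
    rw [hx] at e e'
    rw [hP, hug t ht, add_sub_cancel_right] at e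
    linarith
  have hsteady : IsSteadySolution (derivWithin lam I t₀) g := by
    refine ⟨hgC, hgL, ?_⟩
    set c := derivWithin lam I t₀ with hc
    -- `F'` is `-2/3` times the left side of `hode` at `t₀`, so `F` is the integration constant.
    set F : ℝ → ℝ := fun x => g x / 3 * (2 * c - g x) - L (fun y => g y ^ 2) x with hF
    have hF0 : ∀ x, HasDerivAt F 0 x := fun x => by
      have h := (((hgd x).hasDerivAt.div_const 3).mul
        ((hgd x).hasDerivAt.const_sub (2 * c))).sub (hLd x).hasDerivAt
      have e := hode t₀ ht₀ x
      rw [← hc] at e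
      have e0 : deriv g x / 3 * (2 * c - g x) + g x / 3 * -deriv g x
          - deriv (L fun y => g y ^ 2) x = 0 := by linarith
      rwa [e0] at h
    refine ⟨F 0, fun x => ?_⟩
    have h := is_const_of_deriv_eq_zero (fun x => (hF0 x).differentiableAt)
      (fun x => (hF0 x).deriv) 0 x
    rw [h, hF]
    ring
  set c := derivWithin lam I t₀ with hc
  by_cases hconst : ∀ y, deriv g y = 0
  · have hgk : ∀ x y, g x = g y := is_const_of_deriv_eq_zero hgd hconst
    -- With `g` constant, any `b` will do.
    refine ⟨g, c, 0, hsteady, hug, fun t ht x => (hug t ht x).trans (hgk _ _), fun hn => ?_⟩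
    exact absurd ⟨g 0, fun t ht x => (hug t ht x).trans (hgk _ _)⟩ hn
  · push Not at hconst
    obtain ⟨y, hy⟩ := hconst
    have hspeed : ∀ t ∈ I, HasDerivWithinAt lam c I t := fun t ht => by
      -- Only the `lam'` term of `hode` depends on time; subtract at `t` and `t₀`, then cancel
      -- `deriv g y ≠ 0`.
      have h : derivWithin lam I t = c :=
        mul_right_cancel₀ hy (by linarith [hode t ht y, hode t₀ ht₀ y])
      exact h ▸ hlam' t ht
    have hline : ∀ t ∈ I, lam t = lam t₀ - c * t₀ + c * t := fun t ht => by
      have h : ∀ s ∈ I, HasDerivWithinAt (fun r => lam r - c * r) 0 I s := fun s hs => by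
        have h := (hspeed s hs).sub ((hasDerivWithinAt_id s I).const_mul c)
        rwa [mul_one, sub_self] at h
      linarith [eq_of_hasDerivWithinAt_zero hI h ht ht₀]
    exact ⟨g, c, lam t₀ - c * t₀, hsteady, hug,
      fun t ht x => by rw [← hline t ht]; exact hug t ht x,
      fun _ t ht => ⟨hspeed t ht, hline t ht⟩⟩
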